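/- Let $\Gamma$ be a countable group. A *measure preserving action* $\boldsymbol a=\Gamma\curvearrowright^a(X,\mu)$ is a Borel action $a$ of $\Gamma$ on a standard probability space $(X,\mu)$ that preserves $\mu$; it is *free* if for $\mu$-almost every $x\in X$ the only $\gamma\in\Gamma$ with $\gamma^a x=x$ is the identity. For measure preserving actions $\boldsymbol a=\Gamma\curvearrowright^a(X,\mu)$ and $\boldsymbol b=\Gamma\curvearrowright^b(Y,\nu)$, say that $\boldsymbol a$ is *weakly contained* in $\boldsymbol b$, written $\boldsymbol a\prec\boldsymbol b$, if for every finite Borel partition $A_0,\dots,A_{k-1}$ of $X$, every finite $F\subseteq\Gamma$ and every $\epsilon>0$ there is a Borel partition $B_0,\dots,B_{k-1}$ of $Y$ such that $$|\mu(\gamma^aA_i\cap A_j)-\nu(\gamma^bB_i\cap B_j)|<\epsilon\qquad\text{for all }\gamma\in F,\ 0\le i,j<k,$$ where pieces of partitions may be empty. The actions are *weakly equivalent* if $\boldsymbol a\prec\boldsymbol b$ and $\boldsymbol b\prec\boldsymbol a$. Let $\boldsymbol s_\Gamma=\Gamma\curvearrowright^{s_\Gamma}([0,1]^\Gamma,\lambda^\Gamma)$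 be the Bernoulli shift $(\gamma^{s_\Gamma}f)(\delta)=f(\gamma^{-1}\delta)$, where $\lambda$ is Lebesgue measure on $[0,1]$. **Corollary.** Let $\boldsymbol a=\Gamma\curvearrowright^a(X,\mu)$ be a free measure preserving action of $\Gamma$ on a non-atomic standard probability space $(X,\mu)$. Then the product action $\boldsymbol s_\Gamma\times\boldsymbol a$, given by $\gamma(f,x)=(\gamma^{s_\Gamma}f,\gamma^ax)$ on $([0,1]^\Gamma\times X,\lambda^\Gamma\times\mu)$, is weakly equivalent to $\boldsymbol a$. -/

import Mathlib

open MeasureTheory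

/-- A measurable action of the (discrete) group `Γ` on `X` preserving the measure `μ`. It is a
measure preserving action of a countable group in the usual sense when `Γ` is countable, `X` is a
standard Borel space and `μ` is a probability measure. -/
structure MeasurePreservingAction (Γ : Type*) [Group Γ] {X : Type*} [MeasurableSpace X]
    (μ : Measure X) where
  /-- The map `γ ↦ (x ↦ γ x)`. -/
  act : Γ → X → X
  act_one : ∀ x, act 1 x = x
  act_mul : ∀ γ δ x, act (γ * δ) x = act γ (act δ x)
  measurePreserving : ∀ γ, MeasurePreserving (act γ) μ μ

namespace MeasurePreservingAction

/-- Freeness (modulo null sets): almost every point has trivial stabilizer. -/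
def IsFree {Γ : Type*} [Group Γ] {X : Type*} [MeasurableSpace X] {μ : Measure X}
    (a : MeasurePreservingAction Γ μ) : Prop :=
  ∀ᵐ x ∂μ, ∀ γ : Γ, a.act γ x = x → γ = 1

/-- `A 0, …, A (k-1)` is a partition of `X` into `k` measurable (possibly empty) pieces. -/
def IsMeasurablePartition {X : Type*} [MeasurableSpace X] {k : ℕ} (A : Fin k → Set X) : Prop :=
  (∀ i, MeasurableSet (A i)) ∧ Pairwise (fun i j => Disjoint (A i) (A j)) ∧
    ⋃ i, A i = Set.univ

/-- Weak containment `a ≺ b` of measure preserving actions. -/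
def WeaklyContained {Γ : Type*} [Group Γ] {X Y : Type*} [MeasurableSpace X] [MeasurableSpace Y]
    {μ : Measure X} {ν : Measure Y}
    (a : MeasurePreservingAction Γ μ) (b : MeasurePreservingAction Γ ν) : Prop :=
  ∀ (k : ℕ) (A : Fin k → Set X), IsMeasurablePartition A →
    ∀ (F : Finset Γ) (ε : ℝ), 0 < ε →
      ∃ B : Fin k → Set Y, IsMeasurablePartition B ∧
        ∀ γ ∈ F, ∀ i j : Fin k,
          |μ.real (a.act γ '' A i ∩ A j) - ν.real (b.act γ '' B i ∩ B j)| < ε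

/-- Weak equivalence `a ∼ b` of measure preserving actions. -/
def WeaklyEquivalent {Γ : Type*} [Group Γ] {X Y : Type*} [MeasurableSpace X] [MeasurableSpace Y]
    {μ : Measure X} {ν : Measure Y}
    (a : MeasurePreservingAction Γ μ) (b : MeasurePreservingAction Γ ν) : Prop :=
  WeaklyContained a b ∧ WeaklyContained b a

/-- The product (diagonal) action `γ (x, y) = (γ x, γ y)` on the product measure space. -/
noncomputable def prod {Γ : Type*} [Group Γ] {X Y : Type*} [MeasurableSpace X] [MeasurableSpace Y]
    {μ : Measure X} {ν : Measure Y} [SFinite μ] [SFinite ν]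
    (a : MeasurePreservingAction Γ μ) (b : MeasurePreservingAction Γ ν) :
    MeasurePreservingAction Γ (μ.prod ν) where
  act γ p := (a.act γ p.1, b.act γ p.2)
  act_one p := by simp [a.act_one, b.act_one]
  act_mul γ δ p := by simp [a.act_mul, b.act_mul]
  measurePreserving γ := (a.measurePreserving γ).prod (b.measurePreserving γ)

/-- The Bernoulli shift `(γ f)(δ) = f (γ⁻¹ δ)` of `Γ` on `[0,1]^Γ`, equipped with the product of
the Lebesgue measures on the unit interval. -/
noncomputable def bernoulliShift (Γ : Type*) [Group Γ] :
    MeasurePreservingAction Γ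
      (Measure.infinitePi fun _ : Γ => (volume : Measure unitInterval)) where
  act γ f := fun δ => f (γ⁻¹ * δ)
  act_one f := by simp
  act_mul γ δ f := by
    funext x
    simp [mul_assoc]
  measurePreserving γ := by
    refine ⟨measurable_pi_lambda _ fun δ => measurable_pi_apply _, ?_⟩
    conv_rhs => rw [← Measure.infinitePi_map_piCongrLeft
      (fun _ : Γ => (volume : Measure unitInterval)) (Equiv.mulLeft γ)]
    congr 1
    funext f δ
    obtain ⟨ε, rfl⟩ := (Equiv.mulLeft γ).surjective δ
    rw [MeasurableEquiv.coe_piCongrLeft, Equiv.piCongrLeft_apply_apply]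
    simp

end MeasurePreservingAction

open Filter Topology
open scoped symmDiff

/-! Pulling partitions back along the projection to `X` gives one containment. For the other, embed
`X` in Cantor space, cut it into pieces according to the first `n` bits, and colour the pieces by
independent uniform points `ω` of `[0,1]`. Recording the colours along the orbit of `x`, together
with `x` itself, gives an equivariant map `X → [0,1]^Γ × X`.

For a cylinder set `E`, the measure of the preimage of `E` is a random variable concentrating at the
measure of `E`. Its second moment is, by Fubini, an average over pairs `(x, y)`. Freeness and
non-atomicity make the orbit points of almost every pair distinct, so for large `n` the finitely
many relevant ones lie in different pieces and their colours are independent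
(`tendsto_lintegral_coloringMap_mul`). Hence the variance tends to `0`, and one `ω` serves finitely
many cylinder sets at once (`IsFree.exists_equivariant_map`). Cylinder sets form a generating
algebra, so `exists_partition_approx` reduces arbitrary partitions to cylinder partitions. -/

namespace MeasureTheory

/-! ### Product measures and approximation of partitions. -/

/-- Reindexing a product of copies of one probability measure along an injection. -/
theorem infinitePi_map_comp_injective {ι κ I : Type*} [MeasurableSpace I] (ν : Measure I)
    [IsProbabilityMeasure ν] {t : ι → κ} (ht : Function.Injective t) :
    (Measure.infinitePi fun _ : κ => ν).map (fun ω i => ω (t i)) =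
      Measure.infinitePi fun _ : ι => ν := by
  refine Measure.eq_infinitePi _ fun s u hu => ?_
  rw [Measure.map_apply (measurable_pi_lambda _ fun i => measurable_pi_apply (t i))
    (MeasurableSet.pi s.countable_toSet fun i _ => hu i)]
  have : (fun (ω : κ → I) i => ω (t i)) ⁻¹' (Set.pi s u) =
      Set.pi (s.map ⟨t, ht⟩ : Finset κ) (Function.extend t u fun _ => Set.univ) := by
    ext ω
    simp [Set.mem_pi, ht.extend_apply]
  rw [this, Measure.infinitePi_pi]
  · simp [Finset.prod_map, ht.extend_apply]
  · intro i hi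
    obtain ⟨j, -, rfl⟩ := Finset.mem_map.1 hi
    simpa [ht.extend_apply] using hu j

/-- Membership in `D` depends only on the coordinates in `S`. -/
def DependsOnCoords {ι I : Type*} (S : Finset ι) (D : Set (ι → I)) : Prop :=
  ∀ f g : ι → I, (∀ i ∈ S, f i = g i) → (f ∈ D ↔ g ∈ D)

/-- Independence: the two events read disjoint sets of coordinates of `ω`. Injectivity is needed
only on two copies of `S`, so `s` and `t` may collide elsewhere; this allows a finite `κ`. -/
theorem infinitePi_comp_mem_and_comp_mem {ι κ I : Type*} [MeasurableSpace I] (ν : Measure I)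
    [IsProbabilityMeasure ν] {S : Finset ι} {D D' : Set (ι → I)}
    (hD : MeasurableSet D) (hD' : MeasurableSet D') (hS : DependsOnCoords S D)
    (hS' : DependsOnCoords S D') {s t : ι → κ}
    (hst : Function.Injective (Sum.elim (fun i : S => s i) (fun i : S => t i))) :
    (Measure.infinitePi fun _ : κ => ν) {ω | (fun i => ω (s i)) ∈ D ∧ (fun i => ω (t i)) ∈ D'} =
      (Measure.infinitePi fun _ : ι => ν) D * (Measure.infinitePi fun _ : ι => ν) D' := by
  classical
  -- `c` fills the coordinates outside `S`, where its value cannot affect membership.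
  obtain ⟨c⟩ : Nonempty I := ν.nonempty_of_neZero
  let r : (S → I) → ι → I := fun u i => if h : i ∈ S then u ⟨i, h⟩ else c
  have hr : Measurable r := by
    refine measurable_pi_lambda _ fun i => ?_
    by_cases h : i ∈ S
    · simpa [r, h] using measurable_pi_apply _
    · simp [r, h]
  have hrD : ∀ {D : Set (ι → I)}, DependsOnCoords S D → ∀ f : ι → I,
      r (fun i => f i) ∈ D ↔ f ∈ D := fun h f => h _ _ fun i hi => by simp [r, hi]
  have key : ∀ {D : Set (ι → I)}, MeasurableSet D → DependsOnCoords S D →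
      (Measure.infinitePi fun _ : ι => ν) D = (Measure.pi fun _ : S => ν) (r ⁻¹' D) := by
    intro D hD h
    rw [← Measure.infinitePi_eq_pi, ← infinitePi_map_comp_injective ν
      (Subtype.val_injective : Function.Injective (Subtype.val : S → ι)),
      Measure.map_apply (measurable_pi_lambda _ fun i => measurable_pi_apply _) (hr hD)]
    congr 1
    ext f
    exact (hrD h f).symm
  rw [key hD hS, key hD' hS', ← Measure.prod_prod,
    ← (measurePreserving_sumPiEquivProdPi (fun _ : S ⊕ S => ν)).measure_preimage_equiv,
    ← Measure.infinitePi_eq_pi, ← infinitePi_map_comp_injective ν hst, Measure.map_apply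
      (measurable_pi_lambda _ fun i => measurable_pi_apply _)
      ((MeasurableEquiv.measurable _) ((hr hD).prod (hr hD')))]
  congr 1
  ext ω
  exact and_congr (hrD hS fun i => ω (s i)).symm (hrD hS' fun i => ω (t i)).symm

/-- A finite measurable partition can be approximated by one with pieces in a generating algebra. -/
theorem exists_partition_approx {Z : Type*} [mZ : MeasurableSpace Z] (κ : Measure Z)
    [IsFiniteMeasure κ] {C : Set (Set Z)} (hC : IsSetAlgebra C)
    (hgen : mZ = MeasurableSpace.generateFrom C) {k : ℕ} [NeZero k] {A : Fin k → Set Z}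
    (hA : MeasurePreservingAction.IsMeasurablePartition A) {η : ℝ} (hη : 0 < η) :
    ∃ B : Fin k → Set Z, MeasurePreservingAction.IsMeasurablePartition B ∧ (∀ i, B i ∈ C) ∧
      ∀ i, κ.real (A i ∆ B i) < η := by
  classical
  have hdense := Measure.MeasureDense.of_generateFrom_isSetAlgebra_finite (μ := κ) hC hgen
  have hk : (0 : ℝ) < k := by exact_mod_cast Nat.pos_of_ne_zero (NeZero.ne k)
  have happ : ∀ i, ∃ t ∈ C, κ.real (A i ∆ t) < η / k := fun i => by
    obtain ⟨t, ht, h⟩ := hdense.approx (A i) (hA.1 i) (measure_ne_top _ _) (η / k) (by positivity)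
    exact ⟨t, ht, (ENNReal.lt_ofReal_iff_toReal_lt (measure_ne_top _ _)).1 h⟩
  choose t htC ht using happ
  -- Each point goes to the largest index whose `b` contains it; `b 0 = Set.univ` collects the
  -- points that no other set covers.
  let b : Fin k → Set Z := fun i => if i = 0 then Set.univ else t i
  have hb0 : b 0 = Set.univ := if_pos rfl
  have hbC : ∀ i, b i ∈ C := fun i => by
    by_cases h : i = 0
    · simpa [b, h] using hC.univ_mem
    · simpa [b, h] using htC i
  let B : Fin k → Set Z := fun i => b i \ ⋃ j ∈ Finset.Ioi i, b j
  have hBC : ∀ i, B i ∈ C := fun i => hC.sdiff_mem (hbC i) (hC.biUnion_mem _ fun j _ => hbC j)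
  have hmemB : ∀ z i, z ∈ B i ↔ z ∈ b i ∧ ∀ j, i < j → z ∉ b j := fun z i => by simp [B]
  have hdisj : ∀ z i j, z ∈ B i → z ∈ B j → i = j := fun z i j hi hj => by
    rw [hmemB] at hi hj
    rcases lt_trichotomy i j with h | h | h
    · exact absurd hj.1 (hi.2 j h)
    · exact h
    · exact absurd hi.1 (hj.2 i h)
  refine ⟨B, ⟨fun i => hdense.measurable _ (hBC i), fun i j hij => Set.disjoint_left.2
    fun z hi hj => hij (hdisj z i j hi hj), Set.eq_univ_of_forall fun z => ?_⟩, hBC, fun i => ?_⟩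
  · let T : Finset (Fin k) := Finset.univ.filter fun i => z ∈ b i
    have hT : T.Nonempty := ⟨0, by simp [T, hb0]⟩
    refine Set.mem_iUnion.2 ⟨T.max' hT, (hmemB _ _).2
      ⟨(Finset.mem_filter.1 (T.max'_mem hT)).2, fun j hj hz => ?_⟩⟩
    exact absurd (T.le_max' j (Finset.mem_filter.2 ⟨Finset.mem_univ _, hz⟩)) (not_le.2 hj)
  -- Every error lies in the one exceptional set `⋃ j, A j ∆ t j`, which explains the tolerance `η /
  -- k`.
  · have hgood : ∀ z, z ∉ ⋃ j, A j ∆ t j → ∀ i, z ∈ A i → z ∈ B i := by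
      intro z hz i hzi
      have hiff : ∀ j, z ∈ A j ↔ z ∈ t j := fun j => by
        have : z ∉ A j ∆ t j := fun h => hz (Set.mem_iUnion.2 ⟨j, h⟩)
        rw [Set.mem_symmDiff] at this
        tauto
      refine (hmemB z i).2 ⟨?_, fun j hj hzj => ?_⟩
      · by_cases h : i = 0
        · simp [h, hb0]
        · simpa [b, h] using (hiff i).1 hzi
      · have hj0 : j ≠ 0 := fun h => by simp [h] at hj
        have : z ∈ A j := (hiff j).2 (by simpa [b, hj0] using hzj)
        exact Set.disjoint_left.1 (hA.2.1 hj.ne) hzi this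
    have hsub : A i ∆ B i ⊆ ⋃ j, A j ∆ t j := by
      intro z hz
      by_contra hz'
      rcases hz with ⟨h1, h2⟩ | ⟨h1, h2⟩
      · exact h2 (hgood z hz' i h1)
      · obtain ⟨j, hj⟩ := Set.mem_iUnion.1 (hA.2.2.symm ▸ Set.mem_univ z : z ∈ ⋃ i, A i)
        obtain rfl := hdisj z i j h1 (hgood z hz' j hj)
        exact h2 hj
    calc κ.real (A i ∆ B i) ≤ κ.real (⋃ j, A j ∆ t j) := measureReal_mono hsub
      _ ≤ ∑ j, κ.real (A j ∆ t j) := measureReal_iUnion_fintype_le _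
      _ < ∑ _j : Fin k, η / k :=
        Finset.sum_lt_sum_of_nonempty Finset.univ_nonempty fun j _ => ht j
      _ = η := by simp [mul_div_cancel₀ _ hk.ne']

end MeasureTheory

/-! ### Actions, factors and freeness. -/

namespace MeasurePreservingAction

variable {Γ : Type*} [Group Γ] {X : Type*} [MeasurableSpace X] {μ : Measure X}

theorem image_act_eq_preimage (a : MeasurePreservingAction Γ μ) (γ : Γ) (S : Set X) :
    a.act γ '' S = a.act γ⁻¹ ⁻¹' S := by
  refine congrFun (Set.image_eq_preimage_of_inverse (fun x => ?_) fun x => ?_) S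
  · rw [← a.act_mul, inv_mul_cancel, a.act_one]
  · rw [← a.act_mul, mul_inv_cancel, a.act_one]

theorem measurableSet_image_act (a : MeasurePreservingAction Γ μ) (γ : Γ) {S : Set X}
    (hS : MeasurableSet S) : MeasurableSet (a.act γ '' S) := by
  rw [image_act_eq_preimage]
  exact (a.measurePreserving _).measurable hS

theorem measureReal_image_act (a : MeasurePreservingAction Γ μ) (γ : Γ) {S : Set X}
    (hS : MeasurableSet S) : μ.real (a.act γ '' S) = μ.real S := by
  rw [image_act_eq_preimage, (a.measurePreserving _).measureReal_preimage hS.nullMeasurableSet]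

theorem IsMeasurablePartition.preimage {X Y : Type*} [MeasurableSpace X] [MeasurableSpace Y]
    {k : ℕ} {A : Fin k → Set Y} (hA : IsMeasurablePartition A) {f : X → Y} (hf : Measurable f) :
    IsMeasurablePartition fun i => f ⁻¹' A i :=
  ⟨fun i => hf (hA.1 i), fun _ _ h => (hA.2.1 h).preimage f, by
    rw [← Set.preimage_iUnion, hA.2.2, Set.preimage_univ]⟩

theorem weaklyContained_prod {Y : Type*} [MeasurableSpace Y] {ν : Measure Y}
    [IsProbabilityMeasure ν] [SFinite μ]
    (b : MeasurePreservingAction Γ ν) (a : MeasurePreservingAction Γ μ) :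
    a.WeaklyContained (b.prod a) := by
  intro k A hA F ε hε
  refine ⟨fun i => Prod.snd ⁻¹' A i, hA.preimage measurable_snd, fun γ _ i j => ?_⟩
  have : (b.prod a).act γ '' (Prod.snd ⁻¹' A i) ∩ Prod.snd ⁻¹' A j =
      Set.univ ×ˢ (a.act γ '' A i ∩ A j) := by
    rw [image_act_eq_preimage, image_act_eq_preimage]
    ext p
    simp [prod]
  rw [this, measureReal_prod_prod]
  simpa using hε

/-- For a free action, almost every pair of points has disjoint orbits with trivial stabilizers. -/
theorem IsFree.ae_injective_sumElim [Countable Γ] [StandardBorelSpace X] [IsProbabilityMeasure μ]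
    [NullSingletonClass μ] {a : MeasurePreservingAction Γ μ} (ha : a.IsFree) :
    ∀ᵐ p ∂(μ.prod μ), Function.Injective
      (Sum.elim (fun γ : Γ => a.act γ⁻¹ p.1) fun γ : Γ => a.act γ⁻¹ p.2) := by
  have h1 := (Measure.quasiMeasurePreserving_fst (μ := μ) (ν := μ)).ae ha
  have h2 := (Measure.quasiMeasurePreserving_snd (μ := μ) (ν := μ)).ae ha
  have h3 : ∀ᵐ p ∂(μ.prod μ), ∀ γ : Γ, a.act γ p.1 ≠ p.2 := by
    refine ae_all_iff.2 fun γ => ?_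
    have hm : MeasurableSet {p : X × X | a.act γ p.1 = p.2} := measurableSet_eq_fun
      ((a.measurePreserving γ).measurable.comp measurable_fst) measurable_snd
    have : (μ.prod μ) {p : X × X | a.act γ p.1 = p.2} = 0 := by
      -- The graph of `γ` has singleton slices, which are null as `μ` has no atoms.
      refine (Measure.measure_prod_null hm).2 (ae_of_all _ fun x => ?_)
      refine measure_mono_null (t := {a.act γ x}) (fun y hy => ?_) (measure_singleton _)
      exact (Eq.symm hy : y = _)
    rw [ae_iff]
    simpa using this
  have hinj : ∀ x, (∀ γ : Γ, a.act γ x = x → γ = 1) →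
      Function.Injective fun γ : Γ => a.act γ⁻¹ x := fun x hx γ δ h => by
    have : a.act (δ * γ⁻¹) x = x := by
      rw [a.act_mul, show a.act γ⁻¹ x = a.act δ⁻¹ x from h, ← a.act_mul, mul_inv_cancel, a.act_one]
    exact (mul_inv_eq_one.1 (hx _ this)).symm
  filter_upwards [h1, h2, h3] with p hp1 hp2 hp3
  refine (hinj _ hp1).sumElim (hinj _ hp2) fun γ δ h => hp3 (δ * γ⁻¹) ?_
  rw [a.act_mul, h, ← a.act_mul, mul_inv_cancel, a.act_one]

/-! ### Cylinder sets and colourings. -/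

/-- Measurable sets depending on finitely many coordinates of the first factor. -/
def cylinderSets (Γ I X : Type*) [MeasurableSpace I] [MeasurableSpace X] :
    Set (Set ((Γ → I) × X)) :=
  {E | MeasurableSet E ∧ ∃ S : Finset Γ, ∀ x, DependsOnCoords S {f | (f, x) ∈ E}}

theorem isSetAlgebra_cylinderSets (Γ I X : Type*) [MeasurableSpace I] [MeasurableSpace X] :
    IsSetAlgebra (cylinderSets Γ I X) where
  empty_mem := ⟨.empty, ∅, fun _ _ _ _ => Iff.rfl⟩
  compl_mem := by
    rintro E ⟨hE, S, hS⟩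
    exact ⟨hE.compl, S, fun x f g h => not_congr (hS x f g h)⟩
  union_mem := by
    classical
    rintro E E' ⟨hE, S, hS⟩ ⟨hE', S', hS'⟩
    exact ⟨hE.union hE', S ∪ S', fun x f g h => or_congr
      (hS x f g fun i hi => h i (Finset.mem_union_left _ hi))
      (hS' x f g fun i hi => h i (Finset.mem_union_right _ hi))⟩

theorem generateFrom_cylinderSets (Γ I X : Type*) [MeasurableSpace I] [MeasurableSpace X] :
    (inferInstance : MeasurableSpace ((Γ → I) × X)) =
      MeasurableSpace.generateFrom (cylinderSets Γ I X) := by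
  refine le_antisymm ?_ (MeasurableSpace.generateFrom_le fun E hE => hE.1)
  refine sup_le ?_ ?_
  · rw [← measurable_iff_comap_le]
    refine @measurable_pi_lambda _ _ _ (_) _ _ fun γ s hs => ?_
    refine MeasurableSpace.measurableSet_generateFrom
      ⟨((measurable_pi_apply γ).comp measurable_fst) hs, {γ}, fun x f g h => ?_⟩
    simp [h γ (Finset.mem_singleton_self γ)]
  · rw [← measurable_iff_comap_le]
    intro s hs
    exact MeasurableSpace.measurableSet_generateFrom
      ⟨measurable_snd hs, ∅, fun x f g h => Iff.rfl⟩

theorem image_act_mem_cylinderSets [SFinite μ] (a : MeasurePreservingAction Γ μ) (γ : Γ)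
    {E : Set ((Γ → unitInterval) × X)} (hE : E ∈ cylinderSets Γ unitInterval X) :
    ((bernoulliShift Γ).prod a).act γ '' E ∈ cylinderSets Γ unitInterval X := by
  classical
  obtain ⟨hm, S, hS⟩ := hE
  refine ⟨measurableSet_image_act _ _ hm, S.image (γ * ·), fun x f g h => ?_⟩
  rw [image_act_eq_preimage]
  refine hS (a.act γ⁻¹ x) _ _ fun δ hδ => ?_
  simpa [bernoulliShift] using h _ (Finset.mem_image_of_mem _ hδ)

/-- The equivariant map into the product of the shift with `X` induced by colouring the pieces of
the partition `q` by `ω`. -/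
def coloringMap (a : MeasurePreservingAction Γ μ) {Q I : Type*} (q : X → Q) (ω : Q → I) (x : X) :
    (Γ → I) × X :=
  (fun δ => ω (q (a.act δ⁻¹ x)), x)

theorem measurable_coloringMap (a : MeasurePreservingAction Γ μ) {Q I : Type*} [Countable Q]
    [MeasurableSpace Q] [MeasurableSingletonClass Q] [MeasurableSpace I] {q : X → Q}
    (hq : Measurable q) : Measurable fun p : (Q → I) × X => a.coloringMap q p.1 p.2 := by
  refine Measurable.prodMk (measurable_pi_lambda _ fun δ => ?_) measurable_snd
  have : Measurable fun p : (Q → I) × Q => p.1 p.2 :=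
    measurable_from_prod_countable_left fun c => measurable_pi_apply c
  exact this.comp (measurable_fst.prodMk
    (hq.comp ((a.measurePreserving _).measurable.comp measurable_snd)))

theorem coloringMap_act [SFinite μ] (a : MeasurePreservingAction Γ μ) {Q : Type*} (q : X → Q)
    (ω : Q → unitInterval) (γ : Γ) (x : X) :
    a.coloringMap q ω (a.act γ x) =
      ((bernoulliShift Γ).prod a).act γ (a.coloringMap q ω x) := by
  simp [coloringMap, prod, bernoulliShift, ← a.act_mul]

/-! ### Moments of the random colouring. -/

section Moment

variable {I : Type*} [MeasurableSpace I] (ν : Measure I) [IsProbabilityMeasure ν]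

/-- Fubini turns a moment over random colours into a probability for a fixed pair of points, where
independence can be applied. -/
theorem lintegral_coloringMap_mul [SFinite μ] (a : MeasurePreservingAction Γ μ) {Q : Type*}
    [Countable Q] [MeasurableSpace Q] [MeasurableSingletonClass Q] {q : X → Q} (hq : Measurable q)
    {E E' : Set ((Γ → I) × X)} (hE : MeasurableSet E) (hE' : MeasurableSet E') :
    ∫⁻ ω, μ (a.coloringMap q ω ⁻¹' E) * μ (a.coloringMap q ω ⁻¹' E')
        ∂(Measure.infinitePi fun _ : Q => ν) =
      ∫⁻ p, (Measure.infinitePi fun _ : Q => ν)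
        {ω | a.coloringMap q ω p.1 ∈ E ∧ a.coloringMap q ω p.2 ∈ E'} ∂(μ.prod μ) := by
  let T : Set ((Q → I) × (X × X)) :=
    {z | a.coloringMap q z.1 z.2.1 ∈ E ∧ a.coloringMap q z.1 z.2.2 ∈ E'}
  have hΦ := a.measurable_coloringMap (I := I) hq
  have hT : MeasurableSet T :=
    ((hΦ.comp (measurable_fst.prodMk (measurable_fst.comp measurable_snd))) hE).inter
      ((hΦ.comp (measurable_fst.prodMk (measurable_snd.comp measurable_snd))) hE')
  have h1 := Measure.prod_apply (μ := Measure.infinitePi fun _ : Q => ν) (ν := μ.prod μ) hT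
  rw [Measure.prod_apply_symm hT] at h1
  refine Eq.trans ?_ h1.symm
  refine lintegral_congr fun ω => ?_
  rw [← Measure.prod_prod]
  rfl

/-- Second moments of the random colouring converge, for cylinder sets. -/
theorem tendsto_lintegral_coloringMap_mul [Countable Γ] [StandardBorelSpace X]
    [IsProbabilityMeasure μ] [NullSingletonClass μ] {a : MeasurePreservingAction Γ μ}
    (ha : a.IsFree) {e : X → ℕ → Bool} (he : Measurable e) (hinj : Function.Injective e)
    {E E' : Set ((Γ → I) × X)} (hE : E ∈ cylinderSets Γ I X) (hE' : E' ∈ cylinderSets Γ I X) :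
    Tendsto (fun n : ℕ => ∫⁻ ω, μ (a.coloringMap (fun x (i : Fin n) => e x i) ω ⁻¹' E) *
        μ (a.coloringMap (fun x (i : Fin n) => e x i) ω ⁻¹' E')
        ∂(Measure.infinitePi fun _ : Fin n → Bool => ν)) atTop
      (𝓝 ((Measure.infinitePi fun _ : Γ => ν).prod μ E *
        (Measure.infinitePi fun _ : Γ => ν).prod μ E')) := by
  classical
  have hq : ∀ n : ℕ, Measurable fun x (i : Fin n) => e x i := fun n =>
    measurable_pi_lambda _ fun i => (measurable_pi_apply _).comp he
  have hlim : (Measure.infinitePi fun _ : Γ => ν).prod μ E *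
      (Measure.infinitePi fun _ : Γ => ν).prod μ E' =
      ∫⁻ p, (Measure.infinitePi fun _ : Γ => ν) {f | (f, p.1) ∈ E} *
        (Measure.infinitePi fun _ : Γ => ν) {f | (f, p.2) ∈ E'} ∂(μ.prod μ) := by
    rw [Measure.prod_apply_symm hE.1, Measure.prod_apply_symm hE'.1]
    exact (lintegral_prod_mul (measurable_measure_prodMk_right hE.1).aemeasurable
      (measurable_measure_prodMk_right hE'.1).aemeasurable).symm
  simp_rw [lintegral_coloringMap_mul ν a (hq _) hE.1 hE'.1]
  rw [hlim]
  refine tendsto_lintegral_of_dominated_convergence (fun _ => 1) (fun n => ?_)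
    (fun n => ae_of_all _ fun p => prob_le_one) (by simp) ?_
  · have hΦ := a.measurable_coloringMap (I := I) (hq n)
    have hT : MeasurableSet {z : ((Fin n → Bool) → I) × (X × X) |
        a.coloringMap (fun x (i : Fin n) => e x i) z.1 z.2.1 ∈ E ∧
        a.coloringMap (fun x (i : Fin n) => e x i) z.1 z.2.2 ∈ E'} :=
      ((hΦ.comp (measurable_fst.prodMk (measurable_fst.comp measurable_snd))) hE.1).inter
        ((hΦ.comp (measurable_fst.prodMk (measurable_snd.comp measurable_snd))) hE'.1)
    exact measurable_measure_prodMk_right hT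
  · obtain ⟨hm, S₁, hS₁⟩ := hE
    obtain ⟨hm', S₂, hS₂⟩ := hE'
    filter_upwards [ha.ae_injective_sumElim] with p hp
    -- For a fixed good pair the probability is eventually equal to its limit: finitely many
    -- distinct points are separated by finitely many bits.
    refine tendsto_const_nhds.congr' ?_
    let S := S₁ ∪ S₂
    let t : S ⊕ S → X := Sum.elim (fun γ => a.act (γ : Γ)⁻¹ p.1) fun γ => a.act (γ : Γ)⁻¹ p.2
    have ht : Function.Injective t := by
      have := hp.comp (Sum.map_injective.2 ⟨Subtype.val_injective (p := (· ∈ S)),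
        Subtype.val_injective (p := (· ∈ S))⟩)
      convert this using 1
      ext (i | i) <;> rfl
    have hev : ∀ᶠ n : ℕ in atTop, ∀ u v : S ⊕ S, u ≠ v →
        (fun i : Fin n => e (t u) i) ≠ fun i : Fin n => e (t v) i := by
      refine eventually_all.2 fun u => eventually_all.2 fun v => ?_
      by_cases huv : u = v
      · simp [huv]
      · obtain ⟨m, hmne⟩ := Function.ne_iff.1 (hinj.ne (ht.ne huv))
        filter_upwards [eventually_gt_atTop m] with n hn _ h
        exact hmne (congrFun h ⟨m, hn⟩)
    filter_upwards [hev] with n hn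
    refine (infinitePi_comp_mem_and_comp_mem ν (S := S) (measurable_prodMk_right hm)
      (measurable_prodMk_right hm')
      (fun f g h => hS₁ p.1 f g fun i hi => h i (Finset.mem_union_left _ hi))
      (fun f g h => hS₂ p.2 f g fun i hi => h i (Finset.mem_union_right _ hi))
      (s := fun δ (i : Fin n) => e (a.act δ⁻¹ p.1) i)
      (t := fun δ (i : Fin n) => e (a.act δ⁻¹ p.2) i) ?_).symm
    intro u v huv
    by_contra hne
    refine hn u v hne ?_
    rcases u with u | u <;> rcases v with v | v <;> exact huv

end Moment

/-! ### From moments to weak containment. -/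

/-- A free action maps equivariantly into its product with the Bernoulli shift so that finitely
many cylinder sets pull back to sets of nearly the right measure. -/
theorem IsFree.exists_equivariant_map [Countable Γ] [StandardBorelSpace X]
    [IsProbabilityMeasure μ] [NullSingletonClass μ] {a : MeasurePreservingAction Γ μ}
    (ha : a.IsFree) {J : Type*} [Fintype J] {E : J → Set ((Γ → unitInterval) × X)}
    (hE : ∀ j, E j ∈ cylinderSets Γ unitInterval X) {ε : ℝ} (hε : 0 < ε) :
    ∃ Ψ : X → (Γ → unitInterval) × X, Measurable Ψ ∧
      (∀ γ x, Ψ (a.act γ x) = ((bernoulliShift Γ).prod a).act γ (Ψ x)) ∧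
      ∀ j, |((Measure.infinitePi fun _ : Γ => (volume : Measure unitInterval)).prod μ).real (E j) -
        μ.real (Ψ ⁻¹' E j)| < ε := by
  obtain ⟨e, he, hinj⟩ := MeasurableSpace.measurable_injection_nat_bool_of_countablySeparated X
  set κ := (Measure.infinitePi fun _ : Γ => (volume : Measure unitInterval)).prod μ
  let P : ∀ n : ℕ, Measure ((Fin n → Bool) → unitInterval) := fun n =>
    Measure.infinitePi fun _ : Fin n → Bool => (volume : Measure unitInterval)
  let Φ : ∀ n : ℕ, ((Fin n → Bool) → unitInterval) → X → (Γ → unitInterval) × X := fun n =>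
    a.coloringMap fun x (i : Fin n) => e x i
  have hΦ : ∀ n, Measurable fun p : ((Fin n → Bool) → unitInterval) × X => Φ n p.1 p.2 := fun n =>
    a.measurable_coloringMap (measurable_pi_lambda _ fun i => (measurable_pi_apply _).comp he)
  have hmeas : ∀ n (D : Set ((Γ → unitInterval) × X)), MeasurableSet D →
      Measurable fun ω => μ (Φ n ω ⁻¹' D) := fun n D hD => measurable_measure_prodMk_left (hΦ n hD)
  have hint : ∀ n (D D' : Set ((Γ → unitInterval) × X)), MeasurableSet D → MeasurableSet D' →
      Integrable (fun ω => μ.real (Φ n ω ⁻¹' D) * μ.real (Φ n ω ⁻¹' D')) (P n) := by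
    intro n D D' hD hD'
    refine Integrable.of_bound
      ((hmeas n D hD).ennreal_toReal.mul (hmeas n D' hD').ennreal_toReal).aestronglyMeasurable 1
      (ae_of_all _ fun ω => ?_)
    rw [Real.norm_of_nonneg (by positivity)]
    exact mul_le_one₀ measureReal_le_one measureReal_nonneg measureReal_le_one
  have hmom : ∀ D D', D ∈ cylinderSets Γ unitInterval X → D' ∈ cylinderSets Γ unitInterval X →
      Tendsto (fun n => ∫ ω, μ.real (Φ n ω ⁻¹' D) * μ.real (Φ n ω ⁻¹' D') ∂P n) atTop
        (𝓝 (κ.real D * κ.real D')) := by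
    intro D D' hD hD'
    have h := (ENNReal.tendsto_toReal (ENNReal.mul_ne_top (measure_ne_top κ D)
      (measure_ne_top κ D'))).comp
      (tendsto_lintegral_coloringMap_mul (volume : Measure unitInterval) ha he hinj hD hD')
    rw [ENNReal.toReal_mul] at h
    refine h.congr fun n => ?_
    simp only [Function.comp_apply, measureReal_def, ← ENNReal.toReal_mul]
    exact (integral_toReal ((hmeas n D hD.1).mul (hmeas n D' hD'.1)).aemeasurable
      (ae_of_all _ fun ω => ENNReal.mul_lt_top (measure_lt_top _ _) (measure_lt_top _ _))).symm
  -- Pairing with `Set.univ` yields first moments from the product formula `hmom`.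
  have huniv : Set.univ ∈ cylinderSets Γ unitInterval X :=
    (isSetAlgebra_cylinderSets Γ unitInterval X).univ_mem
  have hexp : ∀ n j ω, (κ.real (E j) - μ.real (Φ n ω ⁻¹' E j)) ^ 2 =
      κ.real (E j) ^ 2 - 2 * κ.real (E j) *
        (μ.real (Φ n ω ⁻¹' E j) * μ.real (Φ n ω ⁻¹' Set.univ)) +
      μ.real (Φ n ω ⁻¹' E j) * μ.real (Φ n ω ⁻¹' E j) := fun n j ω => by
    simp only [Set.preimage_univ, probReal_univ]
    ring
  have hsub : ∀ n j, Integrable (fun ω => κ.real (E j) ^ 2 - 2 * κ.real (E j) *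
      (μ.real (Φ n ω ⁻¹' E j) * μ.real (Φ n ω ⁻¹' Set.univ))) (P n) := fun n j =>
    (integrable_const _).sub ((hint n _ _ (hE j).1 .univ).const_mul _)
  have hi : ∀ n j, Integrable (fun ω => (κ.real (E j) - μ.real (Φ n ω ⁻¹' E j)) ^ 2) (P n) := by
    intro n j
    simp_rw [hexp]
    exact (hsub n j).add (hint n _ _ (hE j).1 (hE j).1)
  have hvar : ∀ j, Tendsto (fun n => ∫ ω, (κ.real (E j) - μ.real (Φ n ω ⁻¹' E j)) ^ 2 ∂P n) atTop
      (𝓝 0) := by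
    intro j
    have h := ((tendsto_const_nhds (x := κ.real (E j) ^ 2)).sub
      ((hmom _ _ (hE j) huniv).const_mul (2 * κ.real (E j)))).add (hmom _ _ (hE j) (hE j))
    have h0 : κ.real (E j) ^ 2 - 2 * κ.real (E j) * (κ.real (E j) * κ.real Set.univ) +
        κ.real (E j) * κ.real (E j) = 0 := by
      rw [probReal_univ]
      ring
    rw [h0] at h
    refine h.congr fun n => ?_
    simp_rw [hexp]
    rw [integral_add (hsub n j) (hint n _ _ (hE j).1 (hE j).1), integral_sub (integrable_const _)
      ((hint n _ _ (hE j).1 .univ).const_mul _), integral_const_mul, integral_const]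
    simp
  have hsum : Tendsto (fun n => ∫ ω, ∑ j, (κ.real (E j) - μ.real (Φ n ω ⁻¹' E j)) ^ 2 ∂P n) atTop
      (𝓝 0) := by
    have h := tendsto_finsetSum Finset.univ fun j _ => hvar j
    rw [Finset.sum_const_zero] at h
    exact h.congr fun n => (integral_finsetSum _ fun j _ => hi n j).symm
  obtain ⟨n, hn⟩ := (hsum.eventually_lt_const (pow_pos hε 2)).exists
  -- Some `ω` does no worse than the mean; since the summed squares are then below `ε ^ 2`, it works
  -- for every `j`.
  obtain ⟨ω, hω⟩ := exists_le_integral (integrable_finsetSum Finset.univ fun j _ => hi n j)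
  refine ⟨Φ n ω, (hΦ n).comp measurable_prodMk_left, fun γ x => coloringMap_act a _ ω γ x,
    fun j => abs_lt_of_sq_lt_sq ?_ hε.le⟩
  exact (Finset.single_le_sum (fun i _ => sq_nonneg (κ.real (E i) - μ.real (Φ n ω ⁻¹' E i)))
    (Finset.mem_univ j)).trans_lt (hω.trans_lt hn)

/-- The product of a free action with the Bernoulli shift is weakly contained in the action. -/
theorem IsFree.bernoulliShift_prod_weaklyContained [Countable Γ] [StandardBorelSpace X]
    [IsProbabilityMeasure μ] [NullSingletonClass μ] {a : MeasurePreservingAction Γ μ}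
    (ha : a.IsFree) : ((bernoulliShift Γ).prod a).WeaklyContained a := by
  intro k A hA F ε hε
  set κ := (Measure.infinitePi fun _ : Γ => (volume : Measure unitInterval)).prod μ
  set c := (bernoulliShift Γ).prod a
  obtain ⟨z⟩ : Nonempty ((Γ → unitInterval) × X) := κ.nonempty_of_neZero
  obtain ⟨i₀, -⟩ := Set.mem_iUnion.1 (hA.2.2.symm ▸ Set.mem_univ z : z ∈ ⋃ i, A i)
  have : NeZero k := ⟨fun h => (h ▸ i₀).elim0⟩
  have hC := isSetAlgebra_cylinderSets Γ unitInterval X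
  -- Replacing both sets of an intersection costs at most `ε / 4` each; the colouring map gets the
  -- remaining `ε / 2`.
  obtain ⟨A', hA', hA'C, happ⟩ := exists_partition_approx κ hC
    (generateFrom_cylinderSets Γ unitInterval X) hA (η := ε / 4) (by positivity)
  obtain ⟨Ψ, hΨ, hequiv, hclose⟩ := ha.exists_equivariant_map (J := F × Fin k × Fin k)
    (E := fun t => c.act (t.1 : Γ) '' A' t.2.1 ∩ A' t.2.2)
    (fun t => hC.inter_mem (image_act_mem_cylinderSets a _ (hA'C _)) (hA'C _)) (half_pos hε)
  refine ⟨fun i => Ψ ⁻¹' A' i, hA'.preimage hΨ, fun γ hγ i j => ?_⟩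
  have hpre : a.act γ '' (Ψ ⁻¹' A' i) ∩ Ψ ⁻¹' A' j = Ψ ⁻¹' (c.act γ '' A' i ∩ A' j) := by
    rw [image_act_eq_preimage, image_act_eq_preimage]
    ext x
    simp [hequiv, c]
  have h1 := hclose (⟨γ, hγ⟩, i, j)
  simp only at h1
  have h2 : |κ.real (c.act γ '' A i ∩ A j) - κ.real (c.act γ '' A' i ∩ A' j)| < ε / 4 + ε / 4 := by
    have hsub : (c.act γ '' A i ∩ A j) ∆ (c.act γ '' A' i ∩ A' j) ⊆
        c.act γ '' (A i ∆ A' i) ∪ A j ∆ A' j := by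
      rw [image_act_eq_preimage, image_act_eq_preimage, image_act_eq_preimage]
      intro x
      simp only [Set.mem_symmDiff, Set.mem_inter_iff, Set.mem_union, Set.mem_preimage]
      tauto
    calc _ ≤ κ.real ((c.act γ '' A i ∩ A j) ∆ (c.act γ '' A' i ∩ A' j)) :=
          abs_measureReal_sub_le_measureReal_symmDiff
            ((measurableSet_image_act _ _ (hA.1 i)).inter (hA.1 j)).nullMeasurableSet
            ((measurableSet_image_act _ _ (hA'.1 i)).inter (hA'.1 j)).nullMeasurableSet
      _ ≤ κ.real (c.act γ '' (A i ∆ A' i)) + κ.real (A j ∆ A' j) :=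
          (measureReal_mono hsub).trans (measureReal_union_le _ _)
      _ < _ := by
          rw [measureReal_image_act _ _ ((hA.1 i).symmDiff (hA'.1 i))]
          exact add_lt_add (happ i) (happ j)
  rw [hpre]
  calc _ ≤ _ := abs_sub_le _ (κ.real (c.act γ '' A' i ∩ A' j)) _
    _ < (ε / 4 + ε / 4) + ε / 2 := add_lt_add h2 h1
    _ = ε := by ring

end MeasurePreservingAction

theorem corollary1p6 {Γ : Type*} [Group Γ] [Countable Γ]
    {X : Type*} [MeasurableSpace X] [StandardBorelSpace X]
    (μ : Measure X) [IsProbabilityMeasure μ] [NullSingletonClass μ]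
    (a : MeasurePreservingAction Γ μ) (ha : a.IsFree) :
    ((MeasurePreservingAction.bernoulliShift Γ).prod a).WeaklyEquivalent a :=
  ⟨ha.bernoulliShift_prod_weaklyContained, MeasurePreservingAction.weaklyContained_prod _ a⟩
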